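/- Let $(V,d)$ be a non-empty compact length space, i.e. a compact metric space in which $d(x,y)$ is, for all $x,y\in V$, the infimum of the lengths of rectifiable paths from $x$ to $y$, and let $f\colon V\to\mathbb{R}$ be continuous. For $\delta>0$ and a bounded function $u_0\colon V\to\mathbb R$ consider the following two-player zero-sum game of horizon $n\ge 0$. A token starts at $x\in V$. In each of $n$ steps, if the token is at $y$, Player II pays Player I the amount $f(y)$; then a fair coin is tossed, independently of the past, and the winner of the toss moves the token to a point of his choice in the closed ball $\{z : d(y,z)\le\delta\}$. After the $n$-th step, if the token is at $z$, Player II pays Player I the amount $u_0(z)$. Strategies may depend on all positions and coin tosses so far. Let $u_n(x)=\sup_{S_{\mathrm I}}\inf_{S_{\mathrm{II}}}F_n(S_{\mathrm I},S_{\mathrm{II}})(x)$ be the value of this game, where $F_n(S_{\mathrm I},S_{\mathrm{II}})(x)$ is the expected total payoff under the strategies $S_{\mathrm I},S_{\mathrm{II}}$ of the two players. Then for every $\delta>0$ there is a unique real number $c_f(\delta)$ such that, for every bounded $u_0$, the sequence of functions $(u_n-n\,c_f(\delta))_{n\ge0}$ is uniformly bounded on $V$ (Player I's long term advantage). Moreover,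 for every $\epsilon>0$ and every integer $n\ge1$, $$\max\bigl\{\,|c_f(\epsilon 2^{-n})-c_f(\epsilon)|,\ |c_f(\epsilon 3^{-n})-c_f(\epsilon)|\,\bigr\}\le \operatorname{osc}(f,2\epsilon),$$ where $\operatorname{osc}(f,r)=\sup_{d(x,y)\le r}|f(x)-f(y)|$. -/

import Mathlib

namespace TugOfWar

/-- A length space: `d(x, y)` is the infimum of the lengths of rectifiable paths from `x` to `y`.
The infimum is taken in `[0, ∞]`; since `edist x y` is finite, the equation forces rectifiable
paths to exist. -/
def IsLengthSpace (V : Type*) [MetricSpace V] : Prop :=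
  ∀ x y : V, edist x y =
    ⨅ (γ : Path x y) (_ : eVariationOn γ Set.univ ≠ ⊤), eVariationOn γ Set.univ

/-- Adjacency in the `ε`-adjacency graph: `x ∼ y` if and only if `d(x, y) ≤ ε`
(in particular there is a loop at every vertex). -/
def adjacency {V : Type*} [MetricSpace V] (ε : ℝ) (x y : V) : Prop :=
  dist x y ≤ ε

/-- The oscillation `osc(v, δ) = sup_{d(x, y) ≤ δ} |v x - v y|`. -/
noncomputable def osc {V : Type*} [MetricSpace V] (v : V → ℝ) (δ : ℝ) : ℝ :=
  sSup {r : ℝ | ∃ x y : V, dist x y ≤ δ ∧ r = |v x - v y|}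

/-- A strategy (of either player) on a graph with adjacency relation `adj`. At each step,
`move x h t` is the vertex to which the player wants to move the token, where `x` is the current
position, `h` lists the earlier positions and `t` lists the coin tosses so far, including the one
of the current step (both lists start with the most recent entry). The vertex has to be a
neighbour of the current position. -/
structure Strategy {V : Type*} (adj : V → V → Prop) where
  move : V → List V → List Bool → V
  legal : ∀ x h t, adj x (move x h t)

/-- The total payment of Player II to Player I during the next `n` steps, when the coin tosses of
these steps are `ω` (`true`: Player I wins the toss and moves, `false`: Player II moves), the token
is at `x`, and `h`, `t` are the earlier positions and coin tosses. In each step, `f` at the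
current position is paid, and after the last step `g` at the final position is paid. -/
def payoff {V : Type*} {adj : V → V → Prop} (f g : V → ℝ) (S₁ S₂ : Strategy adj) :
    (n : ℕ) → (Fin n → Bool) → V → List V → List Bool → ℝ
  | 0, _, x, _, _ => g x
  | n + 1, ω, x, h, t =>
      f x + payoff f g S₁ S₂ n (fun i => ω i.succ)
        (if ω 0 = true then S₁.move x h (ω 0 :: t) else S₂.move x h (ω 0 :: t))
        (x :: h) (ω 0 :: t)

/-- The expected payoff `F_n(S₁, S₂)(x)` in the game of horizon `n` started at `x`, the `n` coin
tosses being fair and independent, that is, uniform on the `2 ^ n` sequences of outcomes. -/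
noncomputable def expectedPayoff {V : Type*} {adj : V → V → Prop} (f g : V → ℝ) (n : ℕ)
    (S₁ S₂ : Strategy adj) (x : V) : ℝ :=
  (∑ ω : Fin n → Bool, payoff f g S₁ S₂ n ω x [] []) / 2 ^ n

/-- The value `u_n(x) = sup_{S₁} inf_{S₂} F_n(S₁, S₂)(x)` for Player I of the game of horizon `n`
with running payoff `f` and terminal payoff `g`. (It coincides with the value
`inf_{S₂} sup_{S₁} F_n(S₁, S₂)(x)` for Player II.) -/
noncomputable def gameValue {V : Type*} (adj : V → V → Prop) (f g : V → ℝ) (n : ℕ) (x : V) : ℝ :=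
  ⨆ S₁ : Strategy adj, ⨅ S₂ : Strategy adj, expectedPayoff f g n S₁ S₂ x

/-- `c` is Player I's long term advantage for the running payoff `f`: for every bounded terminal
payoff `u₀`, the game values `u_n` are such that the functions `u_n - n c` are uniformly bounded. -/
def IsLongTermAdvantage {V : Type*} (adj : V → V → Prop) (f : V → ℝ) (c : ℝ) : Prop :=
  ∀ u₀ : V → ℝ, (∃ B : ℝ, ∀ x, |u₀ x| ≤ B) →
    ∃ C : ℝ, ∀ (n : ℕ) (x : V), |gameValue adj f u₀ n x - n * c| ≤ C

/-- `c_f(ε)`: Player I's long term advantage for the game on the `ε`-adjacency graph on `V` with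
running payoff `f`. -/
noncomputable def longTermAdvantage {V : Type*} [MetricSpace V] (f : V → ℝ) (ε : ℝ) : ℝ :=
  Classical.epsilon (IsLongTermAdvantage (adjacency (V := V) ε) f)

end TugOfWar

namespace TugOfWar

/-! By backward induction, `gameValue` is the `n`-th iterate of `step`, which is monotone and
commutes with adding constants. Growth rates of its iterates can therefore be read off from
functions `w` with `w + a ≤ step w`.

The geometric input is `IsLengthSpace.two_mul_nbhdSup_le`. If the discrete infinity Laplacian of `u`
is at least `-2M`, the suprema of `u` over balls of radius `kδ`, preceded by the infimum over the
`δ`-ball, have second differences at least `-2M`.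

For existence, take the balls to be the whole space. This bounds the oscillation of all iterates of
`0` uniformly, so their values at one point are quasi-additive in `n` and grow linearly up to a
bounded error.

For the comparison of scales, let `N = n + 1` and take `u` with `u + a ≤ step u` at scale `δ`, where
`a` is slightly below `c`. Its supremum over balls of radius `nδ`, divided by `N²`, satisfies the
same inequality at scale `Nδ` with `a - osc` in place of `a`. Hence `c - osc ≤ c'`, and replacing
`f` by `-f` gives the other direction. -/

/-- A real function is bounded. -/
def IsBdd {V : Type*} (u : V → ℝ) : Prop := ∃ B : ℝ, ∀ x, |u x| ≤ B

/-- The supremum of `u` over the neighbours of `x`. -/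
noncomputable def nbhdSup {V : Type*} (adj : V → V → Prop) (u : V → ℝ) (x : V) : ℝ :=
  ⨆ z : {z // adj x z}, u z

/-- The infimum of `u` over the neighbours of `x`. -/
noncomputable def nbhdInf {V : Type*} (adj : V → V → Prop) (u : V → ℝ) (x : V) : ℝ :=
  ⨅ z : {z // adj x z}, u z

/-- The one-step operator of the game with running payoff `f`. -/
noncomputable def step {V : Type*} (adj : V → V → Prop) (f u : V → ℝ) (x : V) : ℝ :=
  f x + (nbhdSup adj u x + nbhdInf adj u x) / 2

/-! ### The one-step operator: monotonicity, constants, sign reversal -/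

section Operator

variable {V : Type*} {adj : V → V → Prop} {f u v : V → ℝ} {x z : V} {a : ℝ}

theorem IsBdd.neg (hu : IsBdd u) : IsBdd (-u) := by
  obtain ⟨B, hB⟩ := hu
  exact ⟨B, fun x => by simpa using hB x⟩

theorem le_nbhdSup (hu : IsBdd u) (h : adj x z) : u z ≤ nbhdSup adj u x := by
  obtain ⟨B, hB⟩ := hu
  refine le_ciSup (f := fun z : {z // adj x z} => u z) ⟨B, ?_⟩ ⟨z, h⟩
  rintro _ ⟨y, rfl⟩
  exact (abs_le.1 (hB y)).2

theorem nbhdInf_le (hu : IsBdd u) (h : adj x z) : nbhdInf adj u x ≤ u z := by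
  obtain ⟨B, hB⟩ := hu
  refine ciInf_le (f := fun z : {z // adj x z} => u z) ⟨-B, ?_⟩ ⟨z, h⟩
  rintro _ ⟨y, rfl⟩
  exact (abs_le.1 (hB y)).1

theorem nbhdSup_le (hx : adj x x) (h : ∀ z, adj x z → u z ≤ a) : nbhdSup adj u x ≤ a := by
  have : Nonempty {z // adj x z} := ⟨⟨x, hx⟩⟩
  exact ciSup_le fun z => h z z.2

theorem le_nbhdInf (hx : adj x x) (h : ∀ z, adj x z → a ≤ u z) : a ≤ nbhdInf adj u x := by
  have : Nonempty {z // adj x z} := ⟨⟨x, hx⟩⟩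
  exact le_ciInf fun z => h z z.2

theorem exists_lt_of_lt_nbhdSup (hx : adj x x) (h : a < nbhdSup adj u x) :
    ∃ z, adj x z ∧ a < u z := by
  by_contra! H
  exact absurd h (not_lt.2 (nbhdSup_le hx H))

theorem exists_lt_of_nbhdInf_lt (hx : adj x x) (h : nbhdInf adj u x < a) :
    ∃ z, adj x z ∧ u z < a := by
  by_contra! H
  exact absurd h (not_lt.2 (le_nbhdInf hx H))

theorem step_le_step_add (hx : adj x x) (hu : IsBdd u) (hv : IsBdd v)
    (h : ∀ y, u y ≤ v y + a) : step adj f u x ≤ step adj f v x + a := by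
  have h1 : nbhdSup adj u x ≤ nbhdSup adj v x + a :=
    nbhdSup_le hx fun z hz => (h z).trans (by linarith [le_nbhdSup hv hz])
  have h2 : nbhdInf adj u x - a ≤ nbhdInf adj v x :=
    le_nbhdInf hx fun z hz => by linarith [h z, nbhdInf_le hu hz]
  unfold step
  linarith

theorem IsBdd.step (hu : IsBdd u) (hadj : ∀ x, adj x x) (hf : IsBdd f) :
    IsBdd (step adj f u) := by
  obtain ⟨F, hF⟩ := hf
  have hu' := hu
  obtain ⟨B, hB⟩ := hu
  refine ⟨F + B, fun x => ?_⟩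
  have h1 : nbhdSup adj u x ≤ B := nbhdSup_le (hadj x) fun z _ => (abs_le.1 (hB z)).2
  have h2 : -B ≤ nbhdInf adj u x := le_nbhdInf (hadj x) fun z _ => (abs_le.1 (hB z)).1
  have h3 := le_nbhdSup hu' (hadj x)
  have h4 := nbhdInf_le hu' (hadj x)
  have h5 := abs_le.1 (hF x)
  have h6 := abs_le.1 (hB x)
  rw [abs_le]
  unfold TugOfWar.step
  constructor <;> linarith

theorem IsBdd.iterate_step (hu : IsBdd u) (hadj : ∀ x, adj x x) (hf : IsBdd f) (n : ℕ) :
    IsBdd ((TugOfWar.step adj f)^[n] u) := by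
  induction n with
  | zero => exact hu
  | succ n ih =>
    rw [Function.iterate_succ_apply']
    exact ih.step hadj hf

theorem iterate_step_le_add (hadj : ∀ x, adj x x) (hf : IsBdd f) (hu : IsBdd u) (hv : IsBdd v)
    (h : ∀ y, u y ≤ v y + a) (n : ℕ) (x : V) :
    (step adj f)^[n] u x ≤ (step adj f)^[n] v x + a := by
  induction n generalizing x with
  | zero => exact h x
  | succ n ih =>
    rw [Function.iterate_succ_apply', Function.iterate_succ_apply']
    exact step_le_step_add (hadj x) (hu.iterate_step hadj hf n) (hv.iterate_step hadj hf n) ih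

/-- Changing all signs exchanges the two players, and the coin is fair; this later halves the work
for two-sided bounds. -/
theorem step_neg_neg (hadj : ∀ x, adj x x) (hu : IsBdd u) :
    step adj (-f) (-u) = -step adj f u := by
  have h1 : ∀ x, nbhdSup adj (-u) x = -nbhdInf adj u x := fun x => by
    apply le_antisymm
    · exact nbhdSup_le (hadj x) fun z hz => neg_le_neg (nbhdInf_le hu hz)
    · exact neg_le.1 (le_nbhdInf (hadj x) fun z hz => neg_le.1 (le_nbhdSup hu.neg hz))
  have h2 : ∀ x, nbhdInf adj (-u) x = -nbhdSup adj u x := fun x => by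
    apply le_antisymm
    · exact le_neg.1 (nbhdSup_le (hadj x) fun z hz => le_neg.1 (nbhdInf_le hu.neg hz))
    · exact le_nbhdInf (hadj x) fun z hz => neg_le_neg (le_nbhdSup hu hz)
  funext x
  simp only [step, h1, h2, Pi.neg_apply]
  ring

theorem iterate_step_neg_neg (hadj : ∀ x, adj x x) (hf : IsBdd f) (hu : IsBdd u) (n : ℕ) :
    (step adj (-f))^[n] (-u) = -(step adj f)^[n] u := by
  induction n with
  | zero => rfl
  | succ n ih =>
    rw [Function.iterate_succ_apply', Function.iterate_succ_apply', ih,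
      step_neg_neg hadj (hu.iterate_step hadj hf n)]

end Operator

/-! ### Dynamic programming for the game -/

section Game

variable {V : Type*} {adj : V → V → Prop} {f g : V → ℝ}

/-- Splitting according to the first coin toss; this is the recursion behind backward induction. -/
theorem sum_payoff_succ (S₁ S₂ : Strategy adj) (n : ℕ) (x : V) (h : List V) (t : List Bool) :
    ∑ ω : Fin (n + 1) → Bool, payoff f g S₁ S₂ (n + 1) ω x h t =
      2 ^ (n + 1) * f x
        + ∑ ω : Fin n → Bool, payoff f g S₁ S₂ n ω (S₁.move x h (true :: t)) (x :: h) (true :: t)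
        + ∑ ω : Fin n → Bool,
            payoff f g S₁ S₂ n ω (S₂.move x h (false :: t)) (x :: h) (false :: t) := by
  rw [← (Fin.consEquiv fun _ : Fin (n + 1) => Bool).sum_comp, Fintype.sum_prod_type,
    Fintype.sum_bool]
  simp only [payoff, Fin.consEquiv_apply, Fin.cons_zero, Fin.cons_succ, Finset.sum_add_distrib,
    Finset.sum_const, if_true, Bool.false_eq_true, if_false, Finset.card_univ, Fintype.card_fun,
    Fintype.card_bool, Fintype.card_fin, nsmul_eq_mul]
  push_cast
  ring

/-- A strategy that, in the game of horizon `n`, moves almost optimally for Player I. -/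
theorem exists_strategy_maximizing (hadj : ∀ x, adj x x) (U : ℕ → V → ℝ) {η : ℝ} (hη : 0 < η)
    (n : ℕ) : ∃ S : Strategy adj, ∀ x h t,
      nbhdSup adj (U (n - 1 - h.length)) x - η ≤ U (n - 1 - h.length) (S.move x h t) := by
  have : ∀ (x : V) (k : ℕ), ∃ z, adj x z ∧ nbhdSup adj (U k) x - η < U k z := fun x k =>
    exists_lt_of_lt_nbhdSup (hadj x) (by linarith)
  choose m hm hm' using this
  exact ⟨⟨fun x h _ => m x (n - 1 - h.length), fun x h _ => hm x _⟩, fun x h _ => (hm' x _).le⟩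

/-- A strategy that, in the game of horizon `n`, moves almost optimally for Player II. -/
theorem exists_strategy_minimizing (hadj : ∀ x, adj x x) (U : ℕ → V → ℝ) {η : ℝ} (hη : 0 < η)
    (n : ℕ) : ∃ S : Strategy adj, ∀ x h t,
      U (n - 1 - h.length) (S.move x h t) ≤ nbhdInf adj (U (n - 1 - h.length)) x + η := by
  have : ∀ (x : V) (k : ℕ), ∃ z, adj x z ∧ U k z < nbhdInf adj (U k) x + η := fun x k =>
    exists_lt_of_nbhdInf_lt (hadj x) (by linarith)
  choose m hm hm' using this
  exact ⟨⟨fun x h _ => m x (n - 1 - h.length), fun x h _ => hm x _⟩, fun x h _ => (hm' x _).le⟩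

theorem exists_strategy_le_expectedPayoff (hadj : ∀ x, adj x x) (hf : IsBdd f) (hg : IsBdd g)
    (n : ℕ) {η : ℝ} (hη : 0 < η) : ∃ S₁ : Strategy adj, ∀ (S₂ : Strategy adj) (x : V),
      (step adj f)^[n] g x - n * η ≤ expectedPayoff f g n S₁ S₂ x := by
  obtain ⟨S₁, hS₁⟩ := exists_strategy_maximizing hadj (fun k => (step adj f)^[k] g) hη n
  refine ⟨S₁, fun S₂ x => ?_⟩
  have key : ∀ (k : ℕ) (x : V) (h : List V) (t : List Bool), h.length + k = n →
      2 ^ k * ((step adj f)^[k] g x - k * η) ≤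
        ∑ ω : Fin k → Bool, payoff f g S₁ S₂ k ω x h t := by
    intro k
    induction k with
    | zero => intro x h t _; simp [payoff]
    | succ k ih =>
      intro x h t hk
      rw [sum_payoff_succ, Function.iterate_succ_apply']
      -- With `k + 1` steps to go, the current move is judged by the value with `k` steps to go. The
      -- length of the history serves as the clock.
      have e : n - 1 - h.length = k := by omega
      have h1 := hS₁ x h (true :: t)
      rw [e] at h1
      have h2 := nbhdInf_le (hg.iterate_step hadj hf k) (S₂.legal x h (false :: t))
      have i1 := ih (S₁.move x h (true :: t)) (x :: h) (true :: t) (by simp; omega)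
      have i2 := ih (S₂.move x h (false :: t)) (x :: h) (false :: t) (by simp; omega)
      have p : (0 : ℝ) < 2 ^ k := by positivity
      have j1 := mul_le_mul_of_nonneg_left h1 p.le
      have j2 := mul_le_mul_of_nonneg_left h2 p.le
      have j3 := mul_pos p hη
      simp only [step] at *
      push_cast
      rw [pow_succ]
      linarith
  unfold expectedPayoff
  rw [le_div_iff₀ (by positivity), mul_comm]
  exact key n x [] [] (by simp)

theorem exists_strategy_expectedPayoff_le (hadj : ∀ x, adj x x) (hf : IsBdd f) (hg : IsBdd g)
    (n : ℕ) {η : ℝ} (hη : 0 < η) : ∃ S₂ : Strategy adj, ∀ (S₁ : Strategy adj) (x : V),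
      expectedPayoff f g n S₁ S₂ x ≤ (step adj f)^[n] g x + n * η := by
  obtain ⟨S₂, hS₂⟩ := exists_strategy_minimizing hadj (fun k => (step adj f)^[k] g) hη n
  refine ⟨S₂, fun S₁ x => ?_⟩
  have key : ∀ (k : ℕ) (x : V) (h : List V) (t : List Bool), h.length + k = n →
      ∑ ω : Fin k → Bool, payoff f g S₁ S₂ k ω x h t ≤
        2 ^ k * ((step adj f)^[k] g x + k * η) := by
    intro k
    induction k with
    | zero => intro x h t _; simp [payoff]
    | succ k ih =>
      intro x h t hk
      rw [sum_payoff_succ, Function.iterate_succ_apply']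
      have e : n - 1 - h.length = k := by omega
      have h1 := hS₂ x h (false :: t)
      rw [e] at h1
      have h2 := le_nbhdSup (hg.iterate_step hadj hf k) (S₁.legal x h (true :: t))
      have i1 := ih (S₁.move x h (true :: t)) (x :: h) (true :: t) (by simp; omega)
      have i2 := ih (S₂.move x h (false :: t)) (x :: h) (false :: t) (by simp; omega)
      have p : (0 : ℝ) < 2 ^ k := by positivity
      have j1 := mul_le_mul_of_nonneg_left h1 p.le
      have j2 := mul_le_mul_of_nonneg_left h2 p.le
      have j3 := mul_pos p hη
      simp only [step] at *
      push_cast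
      rw [pow_succ]
      linarith
  unfold expectedPayoff
  rw [div_le_iff₀ (by positivity), mul_comm]
  exact key n x [] [] (by simp)

theorem abs_payoff_le {F G : ℝ} (hF : ∀ x, |f x| ≤ F) (hG : ∀ x, |g x| ≤ G)
    (S₁ S₂ : Strategy adj) (n : ℕ) (ω : Fin n → Bool) (x : V) (h : List V) (t : List Bool) :
    |payoff f g S₁ S₂ n ω x h t| ≤ n * F + G := by
  induction n generalizing x h t with
  | zero => simpa [payoff] using hG x
  | succ n ih =>
    rw [payoff]
    refine (abs_add_le _ _).trans ?_
    have := ih (fun i => ω i.succ)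
      (if ω 0 = true then S₁.move x h (ω 0 :: t) else S₂.move x h (ω 0 :: t))
      (x :: h) (ω 0 :: t)
    push_cast
    linarith [hF x]

theorem abs_expectedPayoff_le {F G : ℝ} (hF : ∀ x, |f x| ≤ F) (hG : ∀ x, |g x| ≤ G)
    (S₁ S₂ : Strategy adj) (n : ℕ) (x : V) :
    |expectedPayoff f g n S₁ S₂ x| ≤ n * F + G := by
  unfold expectedPayoff
  rw [abs_div, abs_of_pos (by positivity : (0 : ℝ) < 2 ^ n), div_le_iff₀ (by positivity)]
  refine (Finset.abs_sum_le_sum_abs _ _).trans ?_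
  refine (Finset.sum_le_card_nsmul _ _ _ fun ω _ => abs_payoff_le hF hG S₁ S₂ n ω x [] []).trans ?_
  rw [Finset.card_univ, Fintype.card_fun, Fintype.card_bool, Fintype.card_fin, nsmul_eq_mul,
    mul_comm]
  push_cast
  rfl

/-- The value of the game satisfies the dynamic programming principle. -/
theorem gameValue_eq_iterate_step (hadj : ∀ x, adj x x) (hf : IsBdd f) (hg : IsBdd g) (n : ℕ)
    (x : V) : gameValue adj f g n x = (step adj f)^[n] g x := by
  have : Nonempty (Strategy adj) := ⟨⟨fun x _ _ => x, fun x _ _ => hadj x⟩⟩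
  obtain ⟨F, hF⟩ := hf
  obtain ⟨G, hG⟩ := hg
  have bb : ∀ S₁ : Strategy adj,
      BddBelow (Set.range fun S₂ : Strategy adj => expectedPayoff f g n S₁ S₂ x) := by
    rintro S₁
    refine ⟨-(n * F + G), ?_⟩
    rintro _ ⟨S₂, rfl⟩
    exact (abs_le.1 (abs_expectedPayoff_le hF hG S₁ S₂ n x)).1
  have ba : BddAbove (Set.range fun S₁ : Strategy adj =>
      ⨅ S₂ : Strategy adj, expectedPayoff f g n S₁ S₂ x) := by
    refine ⟨n * F + G, ?_⟩
    rintro _ ⟨S₁, rfl⟩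
    exact (ciInf_le (bb S₁) S₁).trans (abs_le.1 (abs_expectedPayoff_le hF hG S₁ S₁ n x)).2
  -- A total error `e` is spread over the `n` moves; the denominator `n + 1` also covers `n = 0`.
  have pos : ∀ e : ℝ, 0 < e → 0 < e / (n + 1) ∧ n * (e / (n + 1)) ≤ e := fun e he => by
    refine ⟨by positivity, ?_⟩
    rw [← mul_div_assoc, div_le_iff₀ (by positivity)]
    linarith
  apply le_antisymm
  · refine le_of_forall_pos_le_add fun e he => ?_
    obtain ⟨S₂, hS₂⟩ := exists_strategy_expectedPayoff_le hadj ⟨F, hF⟩ ⟨G, hG⟩ n (pos e he).1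
    exact ciSup_le fun S₁ => (ciInf_le (bb S₁) S₂).trans
      ((hS₂ S₁ x).trans (by linarith [(pos e he).2]))
  · refine le_of_forall_pos_le_add fun e he => ?_
    obtain ⟨S₁, hS₁⟩ := exists_strategy_le_expectedPayoff hadj ⟨F, hF⟩ ⟨G, hG⟩ n (pos e he).1
    have h1 : (step adj f)^[n] g x - n * (e / (n + 1)) ≤
        ⨅ S₂ : Strategy adj, expectedPayoff f g n S₁ S₂ x := le_ciInf fun S₂ => hS₁ S₂ x
    have h2 := le_ciSup ba S₁
    unfold gameValue
    linarith [(pos e he).2]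

end Game

/-! ### Splitting distances in a length space; oscillation -/

section Length

variable {V : Type*} [MetricSpace V]

/-- In a compact length space every distance is split by a point in any given proportion. -/
theorem IsLengthSpace.exists_dist_eq [CompactSpace V] (hV : IsLengthSpace V) {x y : V} {r : ℝ}
    (hr : 0 ≤ r) (hrd : r ≤ dist x y) : ∃ z, dist x z = r ∧ dist z y ≤ dist x y - r := by
  have approx : ∀ η : ℝ, 0 < η → ∃ z, dist x z = r ∧ dist z y ≤ dist x y - r + η := by
    intro η hη
    have hlt : (⨅ (γ : Path x y) (_ : eVariationOn γ Set.univ ≠ ⊤), eVariationOn γ Set.univ) <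
        ENNReal.ofReal (dist x y + η) := by
      rw [← hV x y, edist_dist]
      exact (ENNReal.ofReal_lt_ofReal_iff (by linarith [dist_nonneg (x := x) (y := y)])).2
        (by linarith)
    obtain ⟨γ, hγ⟩ := iInf_lt_iff.1 hlt
    obtain ⟨_, hlen⟩ := iInf_lt_iff.1 hγ
    have hcont : ContinuousOn (fun t => dist x (γ t)) Set.univ :=
      (continuous_const.dist γ.continuous).continuousOn
    -- A nearly shortest path is cut where its distance from `x` equals `r`; additivity of length
    -- bounds the remaining distance.
    obtain ⟨t, -, ht⟩ := isPreconnected_univ.intermediate_value (Set.mem_univ (0 : unitInterval))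
      (Set.mem_univ 1) hcont (show r ∈ Set.Icc (dist x (γ 0)) (dist x (γ 1)) by simp [hr, hrd])
    refine ⟨γ t, ht, ?_⟩
    have h1 := eVariationOn.edist_le (γ : unitInterval → V)
      (show (0 : unitInterval) ∈ Set.Iic t from t.2.1) (Set.mem_Iic.2 (le_refl t))
    have h2 := eVariationOn.edist_le (γ : unitInterval → V)
      (Set.mem_Ici.2 (le_refl t)) (show (1 : unitInterval) ∈ Set.Ici t from t.2.2)
    have h3 := eVariationOn.add_le_union (γ : unitInterval → V) (s := Set.Iic t) (t := Set.Ici t)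
      fun a ha b hb => le_trans ha hb
    rw [Set.Iic_union_Ici] at h3
    have h4 := ((add_le_add h1 h2).trans h3).trans hlen.le
    rw [γ.source, γ.target, edist_dist, edist_dist,
      ← ENNReal.ofReal_add dist_nonneg dist_nonneg, ENNReal.ofReal_le_ofReal_iff
        (by linarith [dist_nonneg (x := x) (y := y)])] at h4
    simp only at ht
    linarith
  -- Compactness removes the error `η`: a point of the sphere nearest to `y` does at least as well
  -- as every approximate one.
  have hne : {z : V | dist x z = r}.Nonempty := (approx 1 one_pos).imp fun _ h => h.1
  have hcl : IsClosed {z : V | dist x z = r} :=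
    isClosed_eq (continuous_const.dist continuous_id) continuous_const
  obtain ⟨z, hz, hmin⟩ := hcl.isCompact.exists_isMinOn hne
    (continuous_id.dist continuous_const : Continuous fun z => dist z y).continuousOn
  refine ⟨z, hz, le_of_forall_pos_le_add fun η hη => ?_⟩
  obtain ⟨w, hw, hwy⟩ := approx η hη
  exact (hmin hw).trans hwy

theorem IsLengthSpace.exists_dist_le [CompactSpace V] (hV : IsLengthSpace V) {x y : V} {r s : ℝ}
    (hr : 0 ≤ r) (hs : 0 ≤ s) (h : dist x y ≤ r + s) : ∃ z, dist x z ≤ r ∧ dist z y ≤ s := by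
  rcases le_total r (dist x y) with hrd | hrd
  · obtain ⟨z, hz, hzy⟩ := hV.exists_dist_eq hr hrd
    exact ⟨z, hz.le, by linarith⟩
  · exact ⟨y, hrd, by simpa using hs⟩

theorem adjacency_self {δ : ℝ} (hδ : 0 ≤ δ) (x : V) : adjacency δ x x := by
  simpa [adjacency] using hδ

theorem le_add_osc {f : V → ℝ} (hf : IsBdd f) {x y : V} {r : ℝ}
    (h : dist x y ≤ r) : f x ≤ f y + osc f r := by
  obtain ⟨F, hF⟩ := hf
  have hb : BddAbove {s : ℝ | ∃ x y : V, dist x y ≤ r ∧ s = |f x - f y|} := by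
    refine ⟨F + F, ?_⟩
    rintro _ ⟨x, y, -, rfl⟩
    exact (abs_sub _ _).trans (add_le_add (hF x) (hF y))
  have := le_csSup hb ⟨x, y, h, rfl⟩
  unfold osc
  linarith [le_abs_self (f x - f y)]

theorem osc_neg (f : V → ℝ) (r : ℝ) : osc (-f) r = osc f r := by
  unfold osc
  congr 1
  ext s
  simp only [Pi.neg_apply, neg_sub_neg, abs_sub_comm]

end Length

/-! ### Discrete convexity of suprema over balls -/

theorem two_mul_le_of_second_difference {ψ : ℕ → ℝ} {M : ℝ} {N : ℕ}
    (h : ∀ k, k + 2 ≤ 2 * N → 2 * ψ (k + 1) ≤ ψ (k + 2) + ψ k + 2 * M) :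
    2 * ψ N ≤ ψ (2 * N) + ψ 0 + 2 * N ^ 2 * M := by
  -- Increments fall by at most `2M` per step. Comparing each of the first `N` increments with the
  -- one `N` places later costs `2NM` each, hence `2N²M` in total.
  have mono : ∀ j k, k + j + 1 ≤ 2 * N →
      ψ (k + 1) - ψ k ≤ ψ (k + j + 1) - ψ (k + j) + 2 * j * M := by
    intro j k
    induction j with
    | zero => intro _; simp
    | succ j ih =>
      intro hk
      have h1 := ih (by omega)
      have h2 := h (k + j) (by omega)
      push_cast
      rw [show k + (j + 1) + 1 = k + j + 2 by ring, show k + (j + 1) = k + j + 1 by ring]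
      linarith
  have : ∀ m, m ≤ N → ψ m - ψ 0 ≤ ψ (N + m) - ψ N + 2 * (m * N) * M := by
    intro m
    induction m with
    | zero => intro _; simp
    | succ m ih =>
      intro hm
      have h1 := ih (by omega)
      have h2 := mono N m (by omega)
      rw [show m + N + 1 = N + (m + 1) by ring, show m + N = N + m by ring] at h2
      push_cast
      linarith
  have h1 := this N le_rfl
  rw [← two_mul] at h1
  linarith

section Convexity

variable {V : Type*} [MetricSpace V] [CompactSpace V] {u : V → ℝ} {δ : ℝ}

/-- Discrete convexity, in the radius, of the suprema of a discrete subsolution over balls. -/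
theorem IsLengthSpace.two_mul_nbhdSup_le (hV : IsLengthSpace V) (hu : IsBdd u) (hδ : 0 < δ)
    {x : V} {M : ℝ} (n : ℕ)
    (h : ∀ y, dist x y ≤ 2 * n * δ →
      2 * u y ≤ nbhdSup (adjacency δ) u y + nbhdInf (adjacency δ) u y + 2 * M) :
    2 * nbhdSup (adjacency (n * δ)) u x ≤
      nbhdSup (adjacency ((2 * n + 1 : ℕ) * δ)) u x + nbhdInf (adjacency δ) u x
        + 2 * ((n + 1 : ℕ) : ℝ) ^ 2 * M := by
  -- The sequence is shifted by one: `ψ 0` is the infimum over the `δ`-ball and `ψ (k + 1)` the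
  -- supremum over the `kδ`-ball. For `k ≥ 1`, a point `y` of the `kδ`-ball has a `δ`-neighbour in
  -- the `(k - 1)δ`-ball; for `k = 0`, `y = x` and the infimum itself appears.
  have key := two_mul_le_of_second_difference (M := M) (N := n + 1)
    (ψ := fun k => Nat.casesOn k (nbhdInf (adjacency δ) u x)
      fun k => nbhdSup (adjacency (k * δ)) u x) ?_
  · exact key
  · intro k hk
    have hkn : (k : ℝ) ≤ 2 * n := by exact_mod_cast (by omega : k ≤ 2 * n)
    have hself : ∀ j : ℕ, adjacency (j * δ) x x := fun j => adjacency_self (by positivity) x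
    suffices H : ∀ y, adjacency (k * δ) x y → u y ≤
        (nbhdSup (adjacency ((k + 1 : ℕ) * δ)) u x + Nat.casesOn k (nbhdInf (adjacency δ) u x)
          (fun k => nbhdSup (adjacency (k * δ)) u x) + 2 * M) / 2 by
      have := nbhdSup_le (hself k) H
      simp only
      linarith
    intro y hy
    have hy' : dist x y ≤ k * δ := hy
    have h1 := h y (hy'.trans (mul_le_mul_of_nonneg_right hkn hδ.le))
    have h2 : nbhdSup (adjacency δ) u y ≤ nbhdSup (adjacency ((k + 1 : ℕ) * δ)) u x := by
      refine nbhdSup_le (adjacency_self hδ.le y) fun z hz => le_nbhdSup hu ?_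
      have hz' : dist y z ≤ δ := hz
      unfold adjacency
      push_cast
      linarith [dist_triangle x y z]
    cases k with
    | zero =>
      have : x = y := dist_le_zero.1 (by simpa using hy')
      subst this
      have h3 : u x ≤ (nbhdSup (adjacency δ) u x + nbhdInf (adjacency δ) u x + 2 * M) / 2 := by
        linarith
      exact h3.trans (div_le_div_of_nonneg_right
        (add_le_add (add_le_add h2 le_rfl) le_rfl) zero_le_two)
    | succ k =>
      obtain ⟨w, hxw, hwy⟩ := hV.exists_dist_le (x := x) (y := y) (r := k * δ) (s := δ)
        (by positivity) hδ.le (by push_cast at hy'; linarith)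
      have h3 : nbhdInf (adjacency δ) u y ≤ u w :=
        nbhdInf_le hu (show dist y w ≤ δ by rwa [dist_comm])
      have h4 : u w ≤ nbhdSup (adjacency (k * δ)) u x := le_nbhdSup hu hxw
      simp only
      linarith

/-- The oscillation of a function with bounded discrete infinity Laplacian is bounded. -/
theorem IsLengthSpace.exists_sub_le (hV : IsLengthSpace V) (hδ : 0 < δ) (M : ℝ) :
    ∃ K : ℝ, ∀ u : V → ℝ, IsBdd u →
      (∀ y, 2 * u y ≤ nbhdSup (adjacency δ) u y + nbhdInf (adjacency δ) u y + 2 * M) →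
      ∀ x y, u y - u x ≤ K := by
  obtain ⟨D, hD⟩ := Metric.isBounded_iff.1 (isCompact_univ (X := V)).isBounded
  obtain ⟨n, hn⟩ := exists_nat_ge (D / δ)
  rw [div_le_iff₀ hδ] at hn
  refine ⟨2 * ((n + 1 : ℕ) : ℝ) ^ 2 * M, fun u hu h x y => ?_⟩
  have key := hV.two_mul_nbhdSup_le hu hδ (x := x) n fun y _ => h y
  -- As `nδ` is at least the diameter, both balls are the whole space, and one copy of the supremum
  -- cancels in `key`.
  have h1 : nbhdSup (adjacency ((2 * n + 1 : ℕ) * δ)) u x ≤ nbhdSup (adjacency (n * δ)) u x :=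
    nbhdSup_le (adjacency_self (by positivity) x) fun z _ =>
      le_nbhdSup hu ((hD (Set.mem_univ x) (Set.mem_univ z)).trans hn)
  have h2 : u y ≤ nbhdSup (adjacency (n * δ)) u x :=
    le_nbhdSup hu ((hD (Set.mem_univ x) (Set.mem_univ y)).trans hn)
  have h3 := nbhdInf_le hu (adjacency_self hδ.le x)
  linarith

end Convexity

/-! ### Quasi-additive sequences -/

/-- A quasi-additive sequence is at bounded distance from a linear one. -/
theorem exists_abs_sub_mul_le {a : ℕ → ℝ} {K : ℝ} (h : ∀ m n, |a (m + n) - a m - a n| ≤ K) :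
    ∃ c : ℝ, ∀ n, |a n - n * c| ≤ K := by
  have hmul : ∀ n m : ℕ, |a ((m + 1) * n) - (m + 1 : ℕ) * a n| ≤ m * K := by
    intro n m
    induction m with
    | zero => simp
    | succ m ih =>
      have h1 := h ((m + 1) * n) n
      rw [← Nat.succ_mul] at h1
      rw [abs_le] at *
      push_cast at *
      constructor <;> linarith
  have hK : 0 ≤ K := (abs_nonneg _).trans (h 0 0)
  -- Both sides are compared through `a ((m + 1) * (n + 1))`. Any number separating the lower from
  -- the upper quotients is a valid slope.
  have cross : ∀ m n : ℕ, (a (m + 1) - K) / (m + 1 : ℕ) ≤ (a (n + 1) + K) / (n + 1 : ℕ) := by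
    intro m n
    rw [div_le_div_iff₀ (by positivity) (by positivity)]
    have h1 := abs_le.1 (hmul (n + 1) m)
    have h2 := abs_le.1 (hmul (m + 1) n)
    rw [mul_comm (n + 1)] at h2
    push_cast at *
    linarith
  have hbdd : BddAbove (Set.range fun m : ℕ => (a (m + 1) - K) / (m + 1 : ℕ)) := by
    refine ⟨(a (0 + 1) + K) / (0 + 1 : ℕ), ?_⟩
    rintro _ ⟨m, rfl⟩
    exact cross m 0
  refine ⟨⨆ m : ℕ, (a (m + 1) - K) / (m + 1 : ℕ), fun n => ?_⟩
  cases n with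
  | zero => simpa using h 0 0
  | succ n =>
    have h1 := le_ciSup hbdd n
    have h2 := ciSup_le fun m => cross m n
    rw [div_le_iff₀ (by positivity)] at h1
    rw [le_div_iff₀ (by positivity)] at h2
    rw [abs_le]
    constructor <;> linarith


/-! ### Long term advantage through sub-eigenfunctions -/

section Advantage

variable {V : Type*} {adj : V → V → Prop} {f : V → ℝ} {c : ℝ}

theorem isLongTermAdvantage_iff (hadj : ∀ x, adj x x) (hf : IsBdd f) :
    IsLongTermAdvantage adj f c ↔
      ∀ u : V → ℝ, IsBdd u → ∃ C : ℝ, ∀ (n : ℕ) (x : V), |(step adj f)^[n] u x - n * c| ≤ C := by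
  refine forall_congr' fun u => forall_congr' fun hu => ?_
  simp only [gameValue_eq_iterate_step hadj hf hu]

theorem IsLongTermAdvantage.neg (hadj : ∀ x, adj x x) (hf : IsBdd f)
    (h : IsLongTermAdvantage adj f c) : IsLongTermAdvantage adj (-f) (-c) := by
  rw [isLongTermAdvantage_iff hadj hf] at h
  rw [isLongTermAdvantage_iff hadj hf.neg]
  intro u hu
  obtain ⟨C, hC⟩ := h (-u) hu.neg
  refine ⟨C, fun n x => ?_⟩
  have := iterate_step_neg_neg hadj hf hu.neg n
  rw [neg_neg] at this
  rw [this, ← abs_neg]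
  simpa [sub_eq_add_neg, add_comm] using hC n x

theorem le_of_forall_nat_mul_le {a b C : ℝ} (h : ∀ n : ℕ, n * a ≤ n * b + C) : a ≤ b := by
  by_contra! hab
  obtain ⟨n, hn⟩ := exists_nat_gt (C / (a - b))
  rw [div_lt_iff₀ (sub_pos.2 hab)] at hn
  linarith [h n]

theorem isBdd_zero : IsBdd (0 : V → ℝ) := ⟨0, fun _ => by simp⟩

theorem IsLongTermAdvantage.unique [Nonempty V] {c' : ℝ} (h : IsLongTermAdvantage adj f c)
    (h' : IsLongTermAdvantage adj f c') : c = c' := by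
  obtain ⟨C, hC⟩ := h 0 isBdd_zero
  obtain ⟨C', hC'⟩ := h' 0 isBdd_zero
  obtain ⟨x⟩ := ‹Nonempty V›
  apply le_antisymm <;> refine le_of_forall_nat_mul_le (C := C + C') fun n => ?_ <;>
    linarith [abs_le.1 (hC n x), abs_le.1 (hC' n x)]

/-- Iterating `hwa` gives growth at least `n * a`, whereas the iterates of `w` grow like `n * c`. -/
theorem IsLongTermAdvantage.le_of_add_le_step [Nonempty V] (hadj : ∀ x, adj x x) (hf : IsBdd f)
    (h : IsLongTermAdvantage adj f c) {w : V → ℝ} (hw : IsBdd w) {a : ℝ}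
    (hwa : ∀ x, w x + a ≤ step adj f w x) : a ≤ c := by
  rw [isLongTermAdvantage_iff hadj hf] at h
  obtain ⟨C, hC⟩ := h w hw
  obtain ⟨B, hB⟩ := hw
  obtain ⟨x₀⟩ := ‹Nonempty V›
  have iter : ∀ (n : ℕ) (x : V), w x ≤ (step adj f)^[n] w x + -(n * a) := by
    intro n
    induction n with
    | zero => simp
    | succ n ih =>
      intro x
      have h1 := step_le_step_add (f := f) (hadj x) ⟨B, hB⟩
        (IsBdd.iterate_step ⟨B, hB⟩ hadj hf n) ih
      rw [Function.iterate_succ_apply']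
      push_cast
      linarith [hwa x]
  refine le_of_forall_nat_mul_le (C := C + B) fun n => ?_
  linarith [iter n x₀, abs_le.1 (hC n x₀), abs_le.1 (hB x₀)]

/-- Approximate additive eigenfunctions of the one-step operator. -/
theorem IsLongTermAdvantage.exists_add_le_step (hadj : ∀ x, adj x x) (hf : IsBdd f)
    (h : IsLongTermAdvantage adj f c) {a : ℝ} (ha : a < c) :
    ∃ u : V → ℝ, IsBdd u ∧ ∀ x, u x + a ≤ step adj f u x := by
  rw [isLongTermAdvantage_iff hadj hf] at h
  obtain ⟨C, hC⟩ := h 0 isBdd_zero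
  obtain ⟨m, hm⟩ := exists_nat_ge (C / (c - a))
  rw [div_le_iff₀ (sub_pos.2 ha)] at hm
  have hbd := isBdd_zero.iterate_step hadj hf
  set U : ℕ → V → ℝ := fun n => (step adj f)^[n] 0
  have hne : (Finset.range (m + 1)).Nonempty := ⟨0, by simp⟩
  -- One step sends the term of index `n` to that of index `n + 1`, up to adding `a`. Only a maximum
  -- attained at index `0` needs another argument: there the term of index `m + 1` is nonnegative by
  -- the choice of `m`, so it dominates `U 0 = 0`.
  set u : V → ℝ := fun x => (Finset.range (m + 1)).sup' hne fun n => U n x - n * a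
  have hle : ∀ n, n < m + 1 → ∀ x, U n x - n * a ≤ u x := fun n hn x =>
    Finset.le_sup' (fun n => U n x - n * a) (Finset.mem_range.2 hn)
  have hattain : ∀ x, ∃ n < m + 1, u x = U n x - n * a := fun x => by
    obtain ⟨n, hn, h⟩ := Finset.exists_mem_eq_sup' hne fun n => U n x - n * a
    exact ⟨n, Finset.mem_range.1 hn, h⟩
  have hu : IsBdd u := by
    refine ⟨C + m * (c - a), fun x => ?_⟩
    obtain ⟨n, hn, h⟩ := hattain x
    have h1 := abs_le.1 (hC n x)
    have h2 : (n : ℝ) * (c - a) ≤ m * (c - a) :=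
      mul_le_mul_of_nonneg_right (by exact_mod_cast Nat.lt_succ_iff.1 hn) (sub_pos.2 ha).le
    have h3 : 0 ≤ (n : ℝ) * (c - a) := mul_nonneg n.cast_nonneg (sub_pos.2 ha).le
    rw [h, abs_le]
    constructor <;> linarith
  have hstep : ∀ n < m + 1, ∀ x, U (n + 1) x - (n + 1 : ℕ) * a + a ≤ step adj f u x := by
    intro n hn x
    have h1 := step_le_step_add (f := f) (a := n * a) (hadj x) (hbd n) hu
      fun y => by linarith [hle n hn y]
    have h2 : U (n + 1) = step adj f (U n) := Function.iterate_succ_apply' _ _ _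
    rw [h2]
    push_cast
    linarith
  refine ⟨u, hu, fun x => ?_⟩
  obtain ⟨n, hn, h⟩ := hattain x
  rw [h]
  cases n with
  | zero =>
    have h1 := hstep m (by omega) x
    have h2 := (abs_le.1 (hC (m + 1) x)).1
    have h3 : U 0 x = 0 := rfl
    rw [h3]
    push_cast at *
    linarith
  | succ n => exact hstep n (by omega) x

end Advantage

/-! ### Existence of the advantage and comparison of scales -/

section LengthSpace

variable {V : Type*} [MetricSpace V] [CompactSpace V] {f : V → ℝ}

theorem IsLengthSpace.exists_isLongTermAdvantage [Nonempty V] (hV : IsLengthSpace V)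
    (hf : IsBdd f) {δ : ℝ} (hδ : 0 < δ) : ∃ c, IsLongTermAdvantage (adjacency (V := V) δ) f c := by
  have hadj := adjacency_self (V := V) hδ.le
  obtain ⟨F, hF⟩ := id hf
  obtain ⟨F', hF'⟩ := isBdd_zero.step hadj hf
  obtain ⟨K, hK⟩ := hV.exists_sub_le hδ (F + F')
  have hbd := isBdd_zero.iterate_step hadj hf
  set T := step (adjacency (V := V) δ) f with hT
  have hosc : ∀ (n : ℕ) (x y : V), T^[n] 0 y - T^[n] 0 x ≤ K := by
    refine fun n => hK _ (hbd n) fun y => ?_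
    -- From `0 ≤ T 0 + F'`, monotonicity gives `T^[n] 0 ≤ T^[n + 1] 0 + F'`. This bounds the
    -- Laplacian of `T^[n] 0` from below independently of `n`.
    have h1 := iterate_step_le_add hadj hf isBdd_zero (isBdd_zero.step hadj hf) (a := F')
      (fun z => by simpa using neg_le_iff_add_nonneg.1 (abs_le.1 (hF' z)).1) n y
    rw [← Function.iterate_succ_apply, Function.iterate_succ_apply'] at h1
    have h2 := (abs_le.1 (hF y)).2
    rw [← hT] at h1
    have h3 : T (T^[n] 0) y = f y + (nbhdSup (adjacency δ) (T^[n] 0) y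
      + nbhdInf (adjacency δ) (T^[n] 0) y) / 2 := rfl
    linarith
  obtain ⟨x₀⟩ := id ‹Nonempty V›
  -- `T^[n] 0` is within `K` of the constant `T^[n] 0 x₀`, and constants pass through `T^[m]`.
  obtain ⟨c, hc⟩ := exists_abs_sub_mul_le (a := fun n => T^[n] 0 x₀) (K := K) fun m n => by
    have h1 := iterate_step_le_add hadj hf (hbd n) isBdd_zero (a := T^[n] 0 x₀ + K)
      (fun y => by rw [Pi.zero_apply]; linarith [hosc n x₀ y]) m x₀
    have h2 := iterate_step_le_add hadj hf isBdd_zero (hbd n) (a := K - T^[n] 0 x₀)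
      (fun y => by rw [Pi.zero_apply]; linarith [hosc n y x₀]) m x₀
    rw [← hT, ← Function.iterate_add_apply] at h1 h2
    rw [abs_le]
    constructor <;> linarith
  refine ⟨c, (isLongTermAdvantage_iff hadj hf).2 fun u hu => ?_⟩
  obtain ⟨B, hB⟩ := id hu
  -- `B` pays for replacing `u` by `0`, one `K` for moving from `x` to `x₀`, the other for
  -- quasi-additivity.
  refine ⟨2 * K + B, fun n x => ?_⟩
  have h1 := iterate_step_le_add hadj hf hu isBdd_zero (a := B)
    (fun y => by simpa using (abs_le.1 (hB y)).2) n x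
  have h2 := iterate_step_le_add hadj hf isBdd_zero hu (a := B)
    (fun y => by simpa using neg_le_iff_add_nonneg.1 (abs_le.1 (hB y)).1) n x
  have h3 := abs_le.1 (hc n)
  rw [← hT] at *
  rw [abs_le]
  constructor <;> linarith [hosc n x x₀, hosc n x₀ x]

/-- Passing from step size `δ` to a multiple of it decreases the long term advantage by at most an
oscillation. -/
theorem IsLengthSpace.advantage_sub_osc_le [Nonempty V] (hV : IsLengthSpace V) (hf : IsBdd f)
    {δ c c' : ℝ} (hδ : 0 < δ) (n : ℕ) (hc : IsLongTermAdvantage (adjacency (V := V) δ) f c)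
    (hc' : IsLongTermAdvantage (adjacency (V := V) ((n + 1 : ℕ) * δ)) f c') :
    c - osc f (2 * ((n + 1 : ℕ) * δ)) ≤ c' := by
  have hN : (0 : ℝ) < (n + 1 : ℕ) := by positivity
  have hadj' := adjacency_self (V := V) (mul_pos hN hδ).le
  set O := osc f (2 * ((n + 1 : ℕ) * δ))
  have hself : ∀ (k : ℕ) (x : V), adjacency (k * δ) x x := fun k x =>
    adjacency_self (by positivity) x
  refine le_of_forall_lt fun b hb => ?_
  obtain ⟨a, hba, hac⟩ := exists_between (lt_sub_iff_add_lt.1 hb)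
  obtain ⟨u, hu, hua⟩ := hc.exists_add_le_step (adjacency_self hδ.le) hf hac
  refine (lt_sub_iff_add_lt.2 hba).trans_le ?_
  set v : V → ℝ := nbhdSup (adjacency (n * δ)) u with hv
  have hvb : IsBdd fun x => v x / ((n + 1 : ℕ) : ℝ) ^ 2 := by
    obtain ⟨B, hB⟩ := id hu
    refine ⟨B / ((n + 1 : ℕ) : ℝ) ^ 2, fun x => ?_⟩
    rw [abs_div, abs_of_pos (pow_pos hN 2)]
    refine div_le_div_of_nonneg_right (abs_le.2 ⟨?_, ?_⟩) (pow_pos hN 2).le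
    · exact (abs_le.1 (hB x)).1.trans (le_nbhdSup hu (hself n x))
    · exact nbhdSup_le (hself n x) fun z _ => (abs_le.1 (hB z)).2
  refine hc'.le_of_add_le_step hadj' hf hvb fun x => ?_
  -- The points `y` involved lie within `2nδ` of `x`, so `f y ≤ f x + O`. The resulting error
  -- carries the factor `N²`, `N = n + 1`, which the normalisation by `N²` cancels.
  have key := hV.two_mul_nbhdSup_le hu hδ (x := x) (M := f x + O - a) n fun y hy => by
    have h1 := hua y
    have h2 : f y ≤ f x + O := le_add_osc hf (by
      rw [dist_comm]
      push_cast
      linarith)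
    unfold step at h1
    linarith
  -- Radii add up as `2n + 1 = (n + 1) + n`: one large move, then the ball defining `v`.
  have hsup : nbhdSup (adjacency ((2 * n + 1 : ℕ) * δ)) u x / ((n + 1 : ℕ) : ℝ) ^ 2 ≤
      nbhdSup (adjacency ((n + 1 : ℕ) * δ)) (fun x => v x / ((n + 1 : ℕ) : ℝ) ^ 2) x := by
    rw [div_le_iff₀ (pow_pos hN 2)]
    refine nbhdSup_le (hself _ x) fun y hy => ?_
    obtain ⟨z, hxz, hzy⟩ := hV.exists_dist_le (x := x) (y := y) (r := (n + 1 : ℕ) * δ)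
      (s := n * δ) (by positivity) (by positivity) (by
        have hy' : dist x y ≤ _ := hy
        push_cast at *
        linarith)
    rw [← div_le_iff₀ (pow_pos hN 2)]
    refine le_trans ?_ (le_nbhdSup hvb hxz)
    exact div_le_div_of_nonneg_right (le_nbhdSup hu hzy) (pow_pos hN 2).le
  -- Here `n + 1 = 1 + n`: wherever a large move ends, the `nδ`-ball there still meets the `δ`-ball
  -- of `x`.
  have hinf : nbhdInf (adjacency δ) u x / ((n + 1 : ℕ) : ℝ) ^ 2 ≤
      nbhdInf (adjacency ((n + 1 : ℕ) * δ)) (fun x => v x / ((n + 1 : ℕ) : ℝ) ^ 2) x := by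
    refine le_nbhdInf (hself _ x) fun z hz => ?_
    refine div_le_div_of_nonneg_right ?_ (pow_pos hN 2).le
    obtain ⟨y, hxy, hyz⟩ := hV.exists_dist_le (x := x) (y := z) (r := δ)
      (s := n * δ) hδ.le (by positivity) (by
        have hz' : dist x z ≤ _ := hz
        push_cast at *
        linarith)
    exact (nbhdInf_le hu hxy).trans (le_nbhdSup hu (show dist z y ≤ _ by rwa [dist_comm]))
  rw [← hv] at key
  have key' : v x / ((n + 1 : ℕ) : ℝ) ^ 2 ≤
      (nbhdSup (adjacency ((2 * n + 1 : ℕ) * δ)) u x / ((n + 1 : ℕ) : ℝ) ^ 2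
        + nbhdInf (adjacency δ) u x / ((n + 1 : ℕ) : ℝ) ^ 2) / 2 + (f x + O - a) := by
    have e : ∀ s i q : ℝ, ((s / ((n + 1 : ℕ) : ℝ) ^ 2 + i / ((n + 1 : ℕ) : ℝ) ^ 2) / 2 + q)
        * ((n + 1 : ℕ) : ℝ) ^ 2 = (s + i) / 2 + ((n + 1 : ℕ) : ℝ) ^ 2 * q := fun s i q => by
      field_simp
    rw [div_le_iff₀ (pow_pos hN 2), e]
    linarith
  unfold step
  linarith

/-- The one-sided estimate applied to `f` and to `-f`, which has the same oscillation and the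
opposite advantages. -/
theorem IsLengthSpace.abs_advantage_sub_le [Nonempty V] (hV : IsLengthSpace V) (hf : IsBdd f)
    {δ c c' : ℝ} (hδ : 0 < δ) (n : ℕ) (hc : IsLongTermAdvantage (adjacency (V := V) δ) f c)
    (hc' : IsLongTermAdvantage (adjacency (V := V) ((n + 1 : ℕ) * δ)) f c') :
    |c - c'| ≤ osc f (2 * ((n + 1 : ℕ) * δ)) := by
  have h1 := hV.advantage_sub_osc_le hf hδ n hc hc'
  have h2 := hV.advantage_sub_osc_le hf.neg hδ n (hc.neg (adjacency_self hδ.le) hf)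
    (hc'.neg (adjacency_self (by positivity)) hf)
  rw [osc_neg] at h2
  rw [abs_le]
  constructor <;> linarith

theorem IsLengthSpace.isLongTermAdvantage_longTermAdvantage [Nonempty V] (hV : IsLengthSpace V)
    (hf : IsBdd f) {δ : ℝ} (hδ : 0 < δ) :
    IsLongTermAdvantage (adjacency (V := V) δ) f (longTermAdvantage f δ) :=
  Classical.epsilon_spec (hV.exists_isLongTermAdvantage hf hδ)

theorem IsLengthSpace.abs_longTermAdvantage_div_sub_le [Nonempty V] (hV : IsLengthSpace V)
    (hf : IsBdd f) {ε : ℝ} (hε : 0 < ε) {N : ℕ} (hN : 0 < N) :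
    |longTermAdvantage f (ε / N) - longTermAdvantage f ε| ≤ osc f (2 * ε) := by
  obtain ⟨n, rfl⟩ := Nat.exists_eq_succ_of_ne_zero hN.ne'
  have hN' : ((n + 1 : ℕ) : ℝ) ≠ 0 := by positivity
  have hmul : ((n + 1 : ℕ) : ℝ) * (ε / (n + 1 : ℕ)) = ε := mul_div_cancel₀ _ hN'
  have hδ : 0 < ε / (n + 1 : ℕ) := by positivity
  have := hV.abs_advantage_sub_le hf hδ n (hV.isLongTermAdvantage_longTermAdvantage hf hδ)
    (hmul.symm ▸ hV.isLongTermAdvantage_longTermAdvantage hf hε)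
  rwa [hmul] at this

end LengthSpace

end TugOfWar

theorem mainTheorem11 {V : Type*} [MetricSpace V] [CompactSpace V] [Nonempty V]
    (hV : TugOfWar.IsLengthSpace V) (f : C(V, ℝ)) :
    (∀ δ : ℝ, 0 < δ →
      ∃! c : ℝ, TugOfWar.IsLongTermAdvantage (TugOfWar.adjacency (V := V) δ) f c) ∧
    ∀ (ε : ℝ), 0 < ε → ∀ n : ℕ, 1 ≤ n →
      max |TugOfWar.longTermAdvantage f (ε / 2 ^ n) - TugOfWar.longTermAdvantage f ε|
          |TugOfWar.longTermAdvantage f (ε / 3 ^ n) - TugOfWar.longTermAdvantage f ε|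
        ≤ TugOfWar.osc f (2 * ε) := by
  have hf : TugOfWar.IsBdd f := ⟨‖f‖, fun x => f.norm_coe_le_norm x⟩
  refine ⟨fun δ hδ => ?_, fun ε hε n _ => max_le ?_ ?_⟩
  · obtain ⟨c, hc⟩ := hV.exists_isLongTermAdvantage hf hδ
    exact ⟨c, hc, fun _ hc' => hc'.unique hc⟩
  · simpa using hV.abs_longTermAdvantage_div_sub_le hf hε (N := 2 ^ n) (by positivity)
  · simpa using hV.abs_longTermAdvantage_div_sub_le hf hε (N := 3 ^ n) (by positivity)
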